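/- Let $(X,d)$ be a metric space, $u,v\in X$ and $C\in[1,\infty)$. A *$Cuv$-geodesic* is a finite sequence $u_0=u,u_1,\dots,u_n=v$ of points of $X$ with $\sum_{i=1}^n d(u_{i-1},u_i)\le C\,d(u,v)$. A $Cuv$-geodesic $z_0,\dots,z_m$ is an *extension* of a $Cuv$-geodesic $w_0,\dots,w_n$ if $w_0,\dots,w_n$ is a subsequence of it, that is, $w_i=z_{\varphi(i)}$ for some $0=\varphi(0)<\varphi(1)<\dots<\varphi(n)=m$. The *partition corresponding to* a $Cuv$-geodesic $w_0,\dots,w_n$ is the partition of $[0,1]$ with division points $$\alpha_k=\frac{\sum_{i=1}^k d(w_{i-1},w_i)}{\sum_{i=1}^n d(w_{i-1},w_i)},\qquad k=0,\dots,n.$$ Given a finite sequence of $Cuv$-geodesics, each next being an extension of the previous one, the *associated nested family of partitions* is defined as follows. The first partition is the one corresponding to the first geodesic. If $\alpha_0,\dots,\alpha_n$ is the partition associated with a term $w_0,\dots,w_n$ and the next term is $z_0,\dots,z_m$, with $w_i=z_{\varphi(i)}$ as above, then the next partition $\beta_0,\dots,\beta_m$ is the refinement $$\beta_j=\alpha_i+(\alpha_{i+1}-\alpha_i)\,\frac{\sum_{t=\varphi(i)}^{j-1}d(z_t,z_{t+1})}{\sum_{t=\varphi(i)}^{\varphi(i+1)-1}d(z_t,z_{t+1})},\qquad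 \varphi(i)\le j\le\varphi(i+1),\ 0\le i<n.$$ **Theorem.** Suppose that for some points $u,v\in X$ and some $C\in[1,\infty)$ there is a nonempty family of $Cuv$-geodesics, called *marked*, satisfying the following two conditions. 1. There is a constant $c>0$ such that every marked $Cuv$-geodesic $w_0,\dots,w_n$ has two different marked extensions $z_0,\dots,z_m$ and $\widetilde z_0,\dots,\widetilde z_m$ of the same length, in which $w_0,\dots,w_n$ has the same indices (that is, $w_i=z_{\varphi(i)}=\widetilde z_{\varphi(i)}$ with the same $\varphi$), such that: * every sequence $z_0',\dots,z_m'$ in which each $z_i'$ is either $z_i$ or $\widetilde z_i$ is a marked $Cuv$-geodesic; * every point which occurs in both extensions has the same indices in both of them; the two extensions have more common points than $w_0,\dots,w_n$ (that is, $z_i=\widetilde z_i$ for some $i\notin\{\varphi(0),\dots,\varphi(n)\}$); and the subsequence of all common points, $\{z_i: z_i=\widetilde z_i\}$, is a marked $Cuv$-geodesic; * there is a nonempty set $D$ of indices $0<i<m$ such that for every $i\in D$ we have $z_i\neq\widetilde z_i$, $z_{i-1}=\widetilde z_{i-1}$, $z_{i+1}=\widetilde z_{i+1}$, $$\frac{d(z_i,z_{i-1})}{d(z_i,z_{i+1})}=\frac{d(\widetilde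 z_i,z_{i-1})}{d(\widetilde z_i,z_{i+1})},$$ and $$\sum_{i\in D}d(z_i,\widetilde z_i)\ge c\,d(u,v).$$ 2. (Non-accumulation of distortion of partitions.) There is a constant $B\in[1,\infty)$ such that for every finite sequence of marked $Cuv$-geodesics, each next being an extension of the previous one (and for every choice of the index maps $\varphi$, should they not be unique), the final partition $\alpha_0,\dots,\alpha_n$ of the associated nested family is $B$-equivalent to the partition $\beta_0,\dots,\beta_n$ corresponding to the last geodesic of the sequence, that is, $$\frac1B\le\frac{\alpha_{i+1}-\alpha_i}{\beta_{i+1}-\beta_i}\le B,\qquad 0\le i<n$$ (in particular, consecutive points of a marked $Cuv$-geodesic are distinct, so that all quotients make sense). Then $(X,d)$ does not admit a bilipschitz embedding into any Banach space with the Radon–Nikodým property. -/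

import Mathlib

open MeasureTheory
open scoped ENNReal

/-- The Radon-Nikodym property of a Banach space `Y`: every countably additive `Y`-valued measure
of bounded variation which is absolutely continuous with respect to a finite measure `μ` has a
Bochner integrable density with respect to `μ`.  (Asking this only for measure spaces in `Type`
gives formally the weakest property, hence the strongest non-embeddability theorem, and it contains
the case of the unit interval, which is known to be equivalent to the general one.) -/
def HasRNP (Y : Type*) [NormedAddCommGroup Y] [NormedSpace ℝ Y] : Prop :=
  ∀ (Ω : Type) [MeasurableSpace Ω] (μ : Measure Ω) [IsFiniteMeasure μ] (ν : VectorMeasure Ω Y),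
    ν.variation Set.univ < ∞ →
    (∀ s, MeasurableSet s → μ s = 0 → ν s = 0) →
    ∃ g : Ω → Y, Integrable g μ ∧ ∀ s, MeasurableSet s → ν s = ∫ x in s, g x ∂μ

/-- `X` admits a bilipschitz embedding into `Y`. -/
def BilipschitzEmbeds (X Y : Type*) [MetricSpace X] [MetricSpace Y] : Prop :=
  ∃ f : X → Y, (∃ K, LipschitzWith K f) ∧ ∃ K, AntilipschitzWith K f

section Geodesics

variable {X : Type*} [MetricSpace X]

/-- For a finite sequence `w 0, …, w n`: the length `∑_{i < k} d(w i, w (i+1))` of the initial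
piece `w 0, …, w k`. -/
noncomputable def cumLength {n : ℕ} (w : Fin (n + 1) → X) (k : Fin (n + 1)) : ℝ :=
  ∑ i : Fin n with i.castSucc < k, dist (w i.castSucc) (w i.succ)

/-- The finite sequence `w 0, …, w n` is a `C`-geodesic between `u` and `v`. -/
def IsCGeodesic (C : ℝ) (u v : X) {n : ℕ} (w : Fin (n + 1) → X) : Prop :=
  w 0 = u ∧ w (Fin.last n) = v ∧ cumLength w (Fin.last n) ≤ C * dist u v

/-- The sequence `z` extends the sequence `w`: `w` is the subsequence of `z` with indices
`φ 0 < φ 1 < … < φ n`, end points corresponding to end points. -/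
def IsExtensionAlong {n m : ℕ} (φ : Fin (n + 1) → Fin (m + 1))
    (w : Fin (n + 1) → X) (z : Fin (m + 1) → X) : Prop :=
  StrictMono φ ∧ φ 0 = 0 ∧ φ (Fin.last n) = Fin.last m ∧ ∀ i, z (φ i) = w i

/-- The division points `α 0, …, α n` of `[0,1]` corresponding to the sequence `w 0, …, w n`. -/
noncomputable def divisionPoints {n : ℕ} (w : Fin (n + 1) → X) (k : Fin (n + 1)) : ℝ :=
  cumLength w k / cumLength w (Fin.last n)

/-- `β` is the refinement of the partition `α` determined by the extension `z` of a sequence whose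
`i`-th point is `z (φ i)`: each interval `[α i, α (i+1)]` is divided proportionally to the distances
between consecutive points of `z φ(i), …, z φ(i+1)`. -/
def IsRefinementAlong {n m : ℕ} (φ : Fin (n + 1) → Fin (m + 1)) (z : Fin (m + 1) → X)
    (α : Fin (n + 1) → ℝ) (β : Fin (m + 1) → ℝ) : Prop :=
  ∀ (i : Fin n) (j : Fin (m + 1)), φ i.castSucc ≤ j → j ≤ φ i.succ →
    β j = α i.castSucc + (α i.succ - α i.castSucc) *
      (cumLength z j - cumLength z (φ i.castSucc)) /
      (cumLength z (φ i.succ) - cumLength z (φ i.castSucc))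

/-- `IsFinalPartition 𝓜 w α`: there is a finite chain of sequences from the family `𝓜`, each next
one extending the previous one, with last term `w`, such that the final partition of the associated
nested family of partitions of `[0,1]` has the division points `α`. The first partition is the one
corresponding to the first sequence of the chain; each next partition refines the previous one. -/
inductive IsFinalPartition (𝓜 : ∀ n : ℕ, Set (Fin (n + 1) → X)) :
    ∀ {n : ℕ}, (Fin (n + 1) → X) → (Fin (n + 1) → ℝ) → Prop
  | single {n : ℕ} {w : Fin (n + 1) → X} (hw : w ∈ 𝓜 n) :
      IsFinalPartition 𝓜 w (divisionPoints w)
  | extend {n m : ℕ} {w : Fin (n + 1) → X} {α : Fin (n + 1) → ℝ}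
      {φ : Fin (n + 1) → Fin (m + 1)} {z : Fin (m + 1) → X} {β : Fin (m + 1) → ℝ}
      (hw : IsFinalPartition 𝓜 w α) (hz : z ∈ 𝓜 m)
      (hφ : IsExtensionAlong φ w z) (hβ : IsRefinementAlong φ z α β) :
      IsFinalPartition 𝓜 z β

/-- `B`-equivalence of two partitions of `[0,1]` with the same number of division points. (As a
ratio with denominator `0` is `0` here, the lower bound forces all intervals to be nondegenerate, so
that the ratios make sense.) -/
def BEquivalent (B : ℝ) {n : ℕ} (α β : Fin (n + 1) → ℝ) : Prop :=
  ∀ i : Fin n,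
    1 / B ≤ (α i.succ - α i.castSucc) / (β i.succ - β i.castSucc) ∧
      (α i.succ - α i.castSucc) / (β i.succ - β i.castSucc) ≤ B

/-- "Non-accumulation of distortion of partitions" with constant `B`. -/
def NonAccumulation (𝓜 : ∀ n : ℕ, Set (Fin (n + 1) → X)) (B : ℝ) : Prop :=
  ∀ {n : ℕ} (w : Fin (n + 1) → X) (α : Fin (n + 1) → ℝ),
    IsFinalPartition 𝓜 w α → BEquivalent B α (divisionPoints w)

/-- The two sequences `z`, `z'` are extensions of `w` with the properties required from the two
marked extensions, where `𝓜` is the family of marked sequences and `s` is the lower bound for the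
total separation. The common points of the extensions are those `z i` for which `z i = z' i`. -/
structure IsForkedExtension (𝓜 : ∀ n : ℕ, Set (Fin (n + 1) → X)) (s : ℝ) {n m : ℕ}
    (w : Fin (n + 1) → X) (z z' : Fin (m + 1) → X) : Prop where
  mem_left : z ∈ 𝓜 m
  mem_right : z' ∈ 𝓜 m
  ne : z ≠ z'
  /-- both are extensions of `w`, and they have more common points than those of `w` -/
  extends_both : ∃ φ : Fin (n + 1) → Fin (m + 1),
    IsExtensionAlong φ w z ∧ IsExtensionAlong φ w z' ∧ ∃ i, i ∉ Set.range φ ∧ z i = z' i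
  /-- all mixtures of the two extensions are marked -/
  mixture_mem : ∀ y : Fin (m + 1) → X, (∀ i, y i = z i ∨ y i = z' i) → y ∈ 𝓜 m
  /-- a point which occurs in both sequences has the same indices in both of them -/
  same_index : ∀ i j, z i = z' j → z i = z' i ∧ z j = z' j
  /-- the common points form a marked sequence -/
  common_mem : ∃ (k : ℕ) (ψ : Fin (k + 1) → Fin (m + 1)),
    StrictMono ψ ∧ Set.range ψ = {i | z i = z' i} ∧ z ∘ ψ ∈ 𝓜 k
  /-- pairs of distinct points, with neighbours `z (i-1) = z a` and `z (i+1) = z b` common -/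
  separated : ∃ D : Finset (Fin (m + 1)), D.Nonempty ∧
    (∀ i ∈ D, z i ≠ z' i ∧ ∃ a b : Fin (m + 1), a.val + 1 = i.val ∧ i.val + 1 = b.val ∧
      z a = z' a ∧ z b = z' b ∧
      dist (z i) (z a) / dist (z i) (z b) = dist (z' i) (z a) / dist (z' i) (z b)) ∧
    s ≤ ∑ i ∈ D, dist (z i) (z' i)

end Geodesics

/-! Suppose `f` is a bilipschitz map into a space `Y` with the Radon–Nikodým property. Along a chain
of marked geodesics, the nested partitions place every point at a position in `[0,1]`, and later
extensions do not move it. Non-accumulation of distortion bounds distances between consecutive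
points by a fixed multiple of differences of positions, so `f` becomes a Lipschitz function of
position on the union of all the partitions. It extends to `[0,1]` and is there the indefinite
integral of a Bochner integrable `g` (`HasRNP.exists_density`).

For fixed `g`, the total deviation of the integral from affinity, summed over disjoint gaps of the
current partition that get split, tends to zero as the partitions grow (`tendsto_sum_splitDefect`).
This needs no decay of the mesh: it holds for indicators of half-lines and survives `L¹` limits.

On the other hand, each fork offers two points for the same position between common neighbours.
Their deviations differ by the difference of their images, so one deviates by at least half of it.
Choosing the worse point at every index of `D` gives a marked mixture with total deviation bounded
below (`MarkedStage.exists_fork`). Iterating this yields the contradiction. -/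

section LipschitzExtension

/-! ### Extension of Lipschitz functions from subsets of an interval. -/

open Set
open scoped NNReal

variable {Y : Type*} [NormedAddCommGroup Y]

/-- A Lipschitz function with values in a complete space extends to the closure. -/
theorem LipschitzOnWith.exists_extension_closure [CompleteSpace Y] {α : Type*} [MetricSpace α]
    {K : ℝ≥0} {f : α → Y} {s : Set α} (hf : LipschitzOnWith K f s) :
    ∃ g : α → Y, LipschitzOnWith K g (closure s) ∧ EqOn g f s := by
  classical
  let t : Set (closure s) := {x | (x : α) ∈ s}
  have ht : Dense t := by
    intro x
    rw [closure_subtype]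
    have : ((↑) '' t : Set α) = s := by
      ext y
      simp only [mem_image, Subtype.exists, t]
      exact ⟨fun ⟨a, _, h, e⟩ => e ▸ h, fun h => ⟨y, subset_closure h, h, rfl⟩⟩
    rw [this]
    exact x.2
  let f' : t → Y := fun x => f x.1.1
  have hf' : LipschitzWith K f' := fun x y => hf x.2 y.2
  have hext := ht.lipschitzWith_extend hf'
  refine ⟨fun x => if h : x ∈ closure s then ht.extend f' ⟨x, h⟩ else 0, ?_, ?_⟩
  · intro x hx y hy
    simp only [hx, hy, dite_true]
    exact hext ⟨x, hx⟩ ⟨y, hy⟩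
  · intro x hx
    simp only [subset_closure hx, dite_true]
    exact ht.extend_eq hf'.continuous ⟨⟨x, subset_closure hx⟩, hx⟩

variable [NormedSpace ℝ Y]

/-- A Lipschitz function on a closed set containing the end points of `[p, q]` extends to
`[p, q]`, being affine on the gaps. -/
theorem exists_lipschitz_extension_Icc {K : ℝ} (hK : 0 ≤ K) {p q : ℝ} {T : Set ℝ}
    (hT : IsClosed T) (hp : p ∈ T) (hq : q ∈ T) {f : ℝ → Y}
    (hf : ∀ x ∈ T, ∀ y ∈ T, x ≤ y → ‖f y - f x‖ ≤ K * (y - x)) :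
    ∃ g : ℝ → Y, (∀ x ∈ Icc p q, ∀ y ∈ Icc p q, x ≤ y → ‖g y - g x‖ ≤ K * (y - x)) ∧
      EqOn g f (T ∩ Icc p q) := by
  have key : ∀ t ∈ Icc p q, ∃ a ∈ T, ∃ b ∈ T, a ≤ t ∧ t ≤ b ∧
      ∀ x ∈ T, x ≤ a ∨ b ≤ x := by
    intro t ht
    have ha : sSup (T ∩ Iic t) ∈ T ∩ Iic t :=
      (hT.inter isClosed_Iic).csSup_mem ⟨p, hp, ht.1⟩ ⟨t, fun x hx => hx.2⟩
    have hb : sInf (T ∩ Ici t) ∈ T ∩ Ici t :=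
      (hT.inter isClosed_Ici).csInf_mem ⟨q, hq, ht.2⟩ ⟨t, fun x hx => hx.2⟩
    refine ⟨_, ha.1, _, hb.1, ha.2, hb.2, fun x hx => ?_⟩
    rcases le_total x t with h | h
    · exact Or.inl (le_csSup ⟨t, fun x hx => hx.2⟩ ⟨hx, h⟩)
    · exact Or.inr (csInf_le ⟨t, fun x hx => hx.2⟩ ⟨hx, h⟩)
  choose! a haT b hbT hat htb hgap using key
  -- If `a t = b t`, the quotient is `0 / 0 = 0`, so that `g t = f (a t)`.
  let g : ℝ → Y := fun t => f (a t) + ((t - a t) / (b t - a t)) • (f (b t) - f (a t))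
  have hga : ∀ t ∈ Icc p q, ‖g t - f (a t)‖ ≤ K * (t - a t) := by
    intro t ht
    simp only [g, add_sub_cancel_left, norm_smul, Real.norm_eq_abs]
    have h1 := hat t ht
    have h2 := htb t ht
    rcases eq_or_lt_of_le (h1.trans h2) with h | h
    · simp only [← h, sub_self, div_zero, abs_zero, zero_mul]
      exact mul_nonneg hK (by linarith)
    · rw [abs_of_nonneg (div_nonneg (by linarith) (by linarith))]
      calc _ ≤ (t - a t) / (b t - a t) * (K * (b t - a t)) :=
            mul_le_mul_of_nonneg_left (hf _ (haT t ht) _ (hbT t ht) h.le)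
              (div_nonneg (by linarith) (by linarith))
        _ = _ := by field_simp [(sub_pos.2 h).ne']
  have hgb : ∀ t ∈ Icc p q, ‖f (b t) - g t‖ ≤ K * (b t - t) := by
    intro t ht
    have h1 := hat t ht
    have h2 := htb t ht
    rcases eq_or_lt_of_le (h1.trans h2) with h | h
    · simp only [g, ← h, sub_self, smul_zero, add_zero, norm_zero]
      exact mul_nonneg hK (by linarith)
    · have e : f (b t) - g t = ((b t - t) / (b t - a t)) • (f (b t) - f (a t)) := by
        have h3 : (b t - t) / (b t - a t) = 1 - (t - a t) / (b t - a t) := by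
          field_simp [(sub_pos.2 h).ne']; ring
        rw [h3, sub_smul, one_smul]
        simp only [g]; abel
      rw [e, norm_smul, Real.norm_eq_abs, abs_of_nonneg (div_nonneg (by linarith) (by linarith))]
      calc _ ≤ (b t - t) / (b t - a t) * (K * (b t - a t)) :=
            mul_le_mul_of_nonneg_left (hf _ (haT t ht) _ (hbT t ht) h.le)
              (div_nonneg (by linarith) (by linarith))
        _ = _ := by field_simp [(sub_pos.2 h).ne']
  refine ⟨g, fun s hs t ht hst => ?_, fun t ht => ?_⟩
  · rcases eq_or_lt_of_le hst with rfl | hst'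
    · simp
    by_cases h : b s ≤ a t
    · have h1 := hf _ (hbT s hs) _ (haT t ht) h
      have h2 := hgb s hs
      have h3 := hga t ht
      calc ‖g t - g s‖ = ‖(g t - f (a t)) + (f (a t) - f (b s)) + (f (b s) - g s)‖ := by
            congr 1; abel
        _ ≤ K * (t - a t) + K * (a t - b s) + K * (b s - s) :=
            norm_add₃_le.trans (by gcongr)
        _ = _ := by ring
    -- Now `s` and `t` lie in the same gap: their chosen end points agree, and `g` is affine between
    -- them.
    · push Not at h
      have e1 : a s = a t := by
        have := (hgap s hs _ (haT t ht)).resolve_right (not_le.2 h)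
        have h4 := hgap t ht _ (haT s hs)
        rcases h4 with h4 | h4
        · exact le_antisymm h4 this
        · have := hat s hs; have := htb t ht; have := hat t ht
          linarith
      have e2 : b s = b t := by
        have := (hgap t ht _ (hbT s hs)).resolve_left (not_le.2 h)
        have h4 := hgap s hs _ (hbT t ht)
        rcases h4 with h4 | h4
        · have := hat s hs; have := htb s hs; have := htb t ht
          linarith
        · exact le_antisymm h4 this
      have h1 := hat s hs
      have h2 := htb t ht
      have h3 := hf _ (haT t ht) _ (hbT t ht) ((hat t ht).trans h2)
      have e : g t - g s = ((t - s) / (b t - a t)) • (f (b t) - f (a t)) := by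
        simp only [g, e1, e2, add_sub_add_left_eq_sub, ← sub_smul, ← sub_div]
        congr 2; ring
      rcases eq_or_lt_of_le ((hat t ht).trans h2) with h' | h'
      · rw [e, h']
        simp only [sub_self, div_zero, zero_smul, norm_zero]
        exact mul_nonneg hK (by linarith)
      rw [e, norm_smul, Real.norm_eq_abs, abs_of_nonneg (div_nonneg (by linarith) (by linarith))]
      calc _ ≤ (t - s) / (b t - a t) * (K * (b t - a t)) :=
            mul_le_mul_of_nonneg_left h3 (div_nonneg (by linarith) (by linarith))
        _ = _ := by field_simp [(sub_pos.2 h').ne']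
  · have h1 := hat t ht.2
    have h2 := htb t ht.2
    rcases hgap t ht.2 t ht.1 with h | h
    · have e : a t = t := le_antisymm h1 h
      simp [g, e]
    · have e : b t = t := le_antisymm h h2
      rcases eq_or_lt_of_le h1 with h' | h'
      · simp [g, h']
      · simp only [g, e, div_self (sub_pos.2 h').ne', one_smul, add_sub_cancel]

/-- A Lipschitz function on a set of reals, with values in a Banach space, extends to any interval
whose end points are in the set. -/
theorem exists_lipschitz_extension [CompleteSpace Y] {K : ℝ} (hK : 0 ≤ K) {p q : ℝ} {P : Set ℝ}
    (hp : p ∈ P) (hq : q ∈ P) (hP : P ⊆ Icc p q) {f : ℝ → Y}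
    (hf : ∀ x ∈ P, ∀ y ∈ P, x ≤ y → ‖f y - f x‖ ≤ K * (y - x)) :
    ∃ g : ℝ → Y, (∀ x ∈ Icc p q, ∀ y ∈ Icc p q, x ≤ y → ‖g y - g x‖ ≤ K * (y - x)) ∧
      EqOn g f P := by
  have hlip : LipschitzOnWith ⟨K, hK⟩ f P := by
    refine LipschitzOnWith.of_dist_le_mul fun x hx y hy => ?_
    rcases le_total x y with h | h
    · rw [dist_comm, dist_comm x y, dist_eq_norm, Real.dist_eq, abs_of_nonneg (sub_nonneg.2 h)]
      exact hf x hx y hy h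
    · rw [dist_eq_norm, Real.dist_eq, abs_of_nonneg (sub_nonneg.2 h)]
      exact hf y hy x hx h
  obtain ⟨f₁, hf₁, e₁⟩ := hlip.exists_extension_closure
  obtain ⟨g, hg, e₂⟩ := exists_lipschitz_extension_Icc (p := p) (q := q) (f := f₁) hK
    isClosed_closure (subset_closure hp) (subset_closure hq) (fun x hx y hy hxy => by
      have := hf₁.dist_le_mul y hy x hx
      rwa [dist_eq_norm, Real.dist_eq, abs_of_nonneg (sub_nonneg.2 hxy)] at this)
  exact ⟨g, hg, fun x hx => (e₂ ⟨subset_closure hx, hP hx⟩).trans (e₁ hx)⟩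

end LipschitzExtension

/-! ### Lipschitz curves as indefinite Bochner integrals. -/

section Density

open Set

variable {Y : Type*} [NormedAddCommGroup Y] [NormedSpace ℝ Y] [CompleteSpace Y]

/-- In a space with the Radon-Nikodym property, Lipschitz functions on `[0, 1]` are indefinite
Bochner integrals. -/
theorem HasRNP.exists_density (hY : HasRNP Y) {K : ℝ} (hK : 0 ≤ K) {F : ℝ → Y}
    (hF : ∀ x ∈ Icc (0 : ℝ) 1, ∀ y ∈ Icc (0 : ℝ) 1, x ≤ y → ‖F y - F x‖ ≤ K * (y - x)) :
    ∃ g : ℝ → Y, Integrable g (volume.restrict (Ioc 0 1)) ∧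
      ∀ a b, 0 ≤ a → a ≤ b → b ≤ 1 →
        F b - F a = ∫ x in Ioc a b, g x ∂(volume.restrict (Ioc 0 1)) := by
  -- Clamping the argument to `[0,1]` makes every increment on the line bounded by `K` times the
  -- Lebesgue measure restricted to `(0,1]`.
  let G : ℝ → Y := fun t => F (max 0 (min t 1))
  have hG : ∀ u v, u ≤ v → ‖G v - G u‖ₑ ≤
      (ENNReal.ofReal K • volume.restrict (Ioc (0 : ℝ) 1)) (Ioc u v) := by
    intro u v huv
    rw [Measure.smul_apply, Measure.restrict_apply measurableSet_Ioc, Ioc_inter_Ioc,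
      Real.volume_Ioc, smul_eq_mul, ← ENNReal.ofReal_mul hK, ← ofReal_norm]
    apply ENNReal.ofReal_le_ofReal_iff'.2
    by_cases h : v ≤ 0 ∨ 1 ≤ u
    · right
      have : G v = G u := by
        simp only [G]
        congr 1
        rcases h with h | h
        · rw [max_eq_left ((min_le_left _ _).trans h),
            max_eq_left ((min_le_left _ _).trans (huv.trans h))]
        · rw [min_eq_right h, min_eq_right (h.trans huv)]
      simp [this]
    · left
      push Not at h
      have e1 : max 0 (min v 1) = min v 1 := max_eq_right (le_min h.1.le zero_le_one)
      have e2 : max 0 (min u 1) = max u 0 := by rw [min_eq_left h.2.le, max_comm]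
      simp only [G, e1, e2]
      have h0 : max u 0 ≤ min v 1 := max_le (le_min huv h.2.le) (le_min h.1.le zero_le_one)
      exact hF _ ⟨le_max_right _ _, h0.trans (min_le_right _ _)⟩ _
        ⟨(le_max_right _ _).trans h0, min_le_right _ _⟩ h0
  have hgen : (inferInstance : MeasurableSpace ℝ) =
      MeasurableSpace.generateFrom {s | ∃ u v : ℝ, u ≤ v ∧ s = Ioc u v} := by
    refine (BorelSpace.measurable_eq.trans (borel_eq_generateFrom_Ioc_le ℝ)).trans ?_
    congr 1
    ext s
    exact ⟨fun ⟨l, u, h, e⟩ => ⟨l, u, h, e.symm⟩, fun ⟨l, u, h, e⟩ => ⟨l, u, h, e.symm⟩⟩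
  have : IsFiniteMeasure (ENNReal.ofReal K • volume.restrict (Ioc (0 : ℝ) 1)) :=
    Measure.smul_finite _ ENNReal.ofReal_ne_top
  -- Domination by a finite measure extends the increments of `G` to a vector measure, and also
  -- gives its bounded variation and absolute continuity.
  obtain ⟨ν, hν, hle⟩ :=
    VectorMeasure.exists_extension_of_isSetSemiring_of_le_measure_of_generateFrom
    (μ := ENNReal.ofReal K • volume.restrict (Ioc (0 : ℝ) 1)) (m := AddContent.onIoc G)
    IsSetSemiring.Ioc (by
      rintro s ⟨u, v, huv, rfl⟩
      rw [AddContent.onIoc_apply huv]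
      exact hG u v huv) hgen
  obtain ⟨g, hg, hνg⟩ := hY ℝ (volume.restrict (Ioc 0 1)) ν
    (((VectorMeasure.variation_le_of_forall_enorm_le fun E _ => hle E) univ).trans_lt
      (measure_lt_top _ _))
    (fun s _ h => by
      have := hle s
      rw [Measure.smul_apply, h, smul_zero] at this
      simpa using this)
  refine ⟨g, hg, fun a b ha hab hb => ?_⟩
  rw [← hνg _ measurableSet_Ioc, hν _ ⟨a, b, hab, rfl⟩, AddContent.onIoc_apply hab]
  have h1 : ∀ t, 0 ≤ t → t ≤ 1 → G t = F t := fun t h0 h1 => by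
    simp only [G, min_eq_left h1, max_eq_right h0]
  rw [h1 a ha (hab.trans hb), h1 b (ha.trans hab) hb]

end Density

/-! ### Deviation from affinity on one family of split gaps. -/

section Splitting

open Set Filter Topology

/-- A finite family of pairwise disjoint gaps `(a i, b i)` of the set `P`, each of them split by a
point `d i` of the set `Q`. -/
structure IsSplitting {ι : Type*} (P Q : Set ℝ) (D : Finset ι) (a d b : ι → ℝ) : Prop where
  left_mem : ∀ i ∈ D, a i ∈ P
  right_mem : ∀ i ∈ D, b i ∈ P
  mid_mem : ∀ i ∈ D, d i ∈ Q
  left_lt : ∀ i ∈ D, a i < d i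
  lt_right : ∀ i ∈ D, d i < b i
  gap : ∀ i ∈ D, ∀ p ∈ P, p ≤ a i ∨ b i ≤ p
  disjoint : (D : Set ι).PairwiseDisjoint fun i => Ioc (a i) (b i)

variable {Y : Type*} [NormedAddCommGroup Y] [NormedSpace ℝ Y]

/-- The deviation of the indefinite integral of `g` at `d` from affinity on `[a, b]`. -/
noncomputable def splitDefect (μ : Measure ℝ) (g : ℝ → Y) (a d b : ℝ) : Y :=
  (∫ x in Ioc a d, g x ∂μ) - ((d - a) / (b - a)) • ∫ x in Ioc a b, g x ∂μ

theorem splitDefect_add {μ : Measure ℝ} {g h : ℝ → Y} (hg : Integrable g μ) (hh : Integrable h μ)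
    (a d b : ℝ) : splitDefect μ (g + h) a d b = splitDefect μ g a d b + splitDefect μ h a d b := by
  simp only [splitDefect, Pi.add_apply]
  rw [integral_add hg.integrableOn hh.integrableOn, integral_add hg.integrableOn hh.integrableOn,
    smul_add]
  abel

theorem splitDefect_congr_ae {μ : Measure ℝ} {g h : ℝ → Y} (e : g =ᵐ[μ] h) (a d b : ℝ) :
    splitDefect μ g a d b = splitDefect μ h a d b := by
  simp only [splitDefect]
  rw [integral_congr_ae (ae_restrict_of_ae e), integral_congr_ae (ae_restrict_of_ae e)]

variable {ι : Type*} {P Q : Set ℝ} {D : Finset ι} {a d b : ι → ℝ}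

/-- The coefficient in the defect lies in `[0,1]`, so each defect costs at most twice the integral
of `‖g‖` over its gap, and the gaps are disjoint. This uniform bound makes vanishing of total
defects stable under `L¹` limits. -/
theorem IsSplitting.sum_norm_splitDefect_le (H : IsSplitting P Q D a d b) {μ : Measure ℝ}
    {g : ℝ → Y} (hg : Integrable g μ) :
    ∑ i ∈ D, ‖splitDefect μ g (a i) (d i) (b i)‖ ≤ 2 * ∫ x, ‖g x‖ ∂μ := by
  have h1 : ∀ i ∈ D, ‖splitDefect μ g (a i) (d i) (b i)‖ ≤
      2 * ∫ x in Ioc (a i) (b i), ‖g x‖ ∂μ := by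
    intro i hi
    have hl := H.left_lt i hi
    have hr := H.lt_right i hi
    have h2 : ‖∫ x in Ioc (a i) (d i), g x ∂μ‖ ≤ ∫ x in Ioc (a i) (b i), ‖g x‖ ∂μ :=
      (norm_integral_le_integral_norm _).trans (setIntegral_mono_set hg.norm.integrableOn
        (ae_of_all _ fun x => norm_nonneg _) (Ioc_subset_Ioc_right hr.le).eventuallyLE)
    have h3 : ‖((d i - a i) / (b i - a i)) • ∫ x in Ioc (a i) (b i), g x ∂μ‖ ≤
        ∫ x in Ioc (a i) (b i), ‖g x‖ ∂μ := by
      rw [norm_smul, Real.norm_eq_abs,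
        abs_of_nonneg (div_nonneg (by linarith) (by linarith))]
      exact (mul_le_of_le_one_left (norm_nonneg _)
        (div_le_one_of_le₀ (by linarith) (by linarith))).trans (norm_integral_le_integral_norm _)
    calc _ ≤ _ := norm_sub_le _ _
      _ ≤ _ := add_le_add h2 h3
      _ = _ := by ring
  refine (Finset.sum_le_sum h1).trans ?_
  rw [← Finset.mul_sum, ← integral_biUnion_finset D (fun i _ => measurableSet_Ioc) H.disjoint
    (fun i _ => hg.norm.integrableOn)]
  exact mul_le_mul_of_nonneg_left
    (setIntegral_le_integral hg.norm (ae_of_all _ fun x => norm_nonneg _)) zero_le_two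

theorem setIntegral_Ioc_indicator_Iic [CompleteSpace Y] (c : Y) {p q t : ℝ} (hp : 0 ≤ p) (hq : q ≤ 1) :
    ∫ x in Ioc p q, (Iic t).indicator (fun _ => c) x ∂(volume.restrict (Ioc 0 1)) =
      max 0 (min q t - p) • c := by
  rw [setIntegral_indicator measurableSet_Iic, setIntegral_const, Measure.real,
    Measure.restrict_apply (measurableSet_Ioc.inter measurableSet_Iic)]
  have : Ioc p q ∩ Iic t ∩ Ioc 0 1 = Ioc p (min q t) := by
    ext x
    simp only [mem_inter_iff, mem_Ioc, mem_Iic, le_min_iff]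
    constructor
    · rintro ⟨⟨⟨h1, h2⟩, h3⟩, h4⟩
      exact ⟨h1, h2, h3⟩
    · rintro ⟨h1, h2, h3⟩
      exact ⟨⟨⟨h1, h2⟩, h3⟩, hp.trans_lt h1, h2.trans hq⟩
  rw [this, Real.volume_Ioc, ENNReal.toReal_ofReal', max_comm]

/-- The indicator function of a half-line has a nonzero defect in at most one gap, and the defect
is controlled by the shrinking of the gap around the end point of the half-line. -/
theorem IsSplitting.sum_norm_splitDefect_Iic_le [CompleteSpace Y] (H : IsSplitting P Q D a d b)
    (hP : P ⊆ Icc 0 1) (hQ : Q ⊆ Icc 0 1) (hPQ : P ⊆ Q) (h0 : 0 ∈ P) (h1 : 1 ∈ P) (c : Y)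
    {t : ℝ} (ht : t ∈ Icc (0 : ℝ) 1) :
    ∑ i ∈ D, ‖splitDefect (volume.restrict (Ioc 0 1)) ((Iic t).indicator fun _ => c)
        (a i) (d i) (b i)‖ ≤
      ((sSup (Q ∩ Iic t) - sSup (P ∩ Iic t)) + (sInf (P ∩ Ici t) - sInf (Q ∩ Ici t))) * ‖c‖ := by
  have hPI : (P ∩ Iic t).Nonempty := ⟨0, h0, ht.1⟩
  have hPJ : (P ∩ Ici t).Nonempty := ⟨1, h1, ht.2⟩
  have hbI : ∀ R : Set ℝ, BddAbove (R ∩ Iic t) := fun R => ⟨t, fun x hx => hx.2⟩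
  have hbJ : ∀ R : Set ℝ, BddBelow (R ∩ Ici t) := fun R => ⟨t, fun x hx => hx.2⟩
  have hS : sSup (P ∩ Iic t) ≤ sSup (Q ∩ Iic t) :=
    csSup_le_csSup (hbI Q) hPI (inter_subset_inter_left _ hPQ)
  have hI : sInf (Q ∩ Ici t) ≤ sInf (P ∩ Ici t) :=
    csInf_le_csInf (hbJ Q) hPJ (inter_subset_inter_left _ hPQ)
  have key : ∀ i ∈ D, splitDefect (volume.restrict (Ioc 0 1)) ((Iic t).indicator fun _ => c)
        (a i) (d i) (b i) = (max 0 (min (d i) t - a i) -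
          (d i - a i) / (b i - a i) * max 0 (min (b i) t - a i)) • c := by
    intro i hi
    have ha := hP (H.left_mem i hi)
    rw [splitDefect, setIntegral_Ioc_indicator_Iic c ha.1 (hQ (H.mid_mem i hi)).2,
      setIntegral_Ioc_indicator_Iic c ha.1 (hP (H.right_mem i hi)).2, smul_smul, sub_smul]
  -- The indicator is constant on a gap without `t` in its interior, so its integral is affine
  -- there.
  have hzero : ∀ i ∈ D, t ∉ Ioo (a i) (b i) →
      splitDefect (volume.restrict (Ioc 0 1)) ((Iic t).indicator fun _ => c)
        (a i) (d i) (b i) = 0 := by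
    intro i hi hti
    have hl := H.left_lt i hi
    have hr := H.lt_right i hi
    rw [key i hi]
    rcases le_or_gt t (a i) with h | h
    · rw [max_eq_left (by linarith [min_le_right (d i) t]),
        max_eq_left (by linarith [min_le_right (b i) t])]
      simp
    · have h' : b i ≤ t := le_of_not_gt fun h' => hti ⟨h, h'⟩
      rw [min_eq_left h', min_eq_left (by linarith), max_eq_right (by linarith),
        max_eq_right (by linarith), div_mul_cancel₀ _ (by linarith)]
      simp
  by_cases hex : ∃ i ∈ D, t ∈ Ioo (a i) (b i)
  · obtain ⟨i, hi, hti⟩ := hex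
    have hl := H.left_lt i hi
    have hr := H.lt_right i hi
    rw [Finset.sum_eq_single_of_mem i hi]
    · have ea : sSup (P ∩ Iic t) = a i := by
        refine le_antisymm (csSup_le hPI fun x hx => ?_)
          (le_csSup (hbI P) ⟨H.left_mem i hi, hti.1.le⟩)
        exact (H.gap i hi x hx.1).resolve_right (not_le.2 (lt_of_le_of_lt hx.2 hti.2))
      have eb : sInf (P ∩ Ici t) = b i := by
        refine le_antisymm (csInf_le (hbJ P) ⟨H.right_mem i hi, hti.2.le⟩)
          (le_csInf hPJ fun x hx => ?_)
        exact (H.gap i hi x hx.1).resolve_left (not_le.2 (lt_of_lt_of_le hti.1 hx.2))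
      rw [key i hi, norm_smul, min_eq_right hti.2.le, max_eq_right (sub_nonneg.2 hti.1.le)]
      refine mul_le_mul_of_nonneg_right ?_ (norm_nonneg _)
      have hba : 0 < b i - a i := by linarith
      -- If `d i` is to the right of `t`, the right end of the gap around `t` moves in by at least
      -- `b i - d i`; otherwise the left end moves in by at least `d i - a i`. This length times a
      -- factor in `[0,1]` is the defect.
      rcases le_total t (d i) with h | h
      · have h2 : sInf (Q ∩ Ici t) ≤ d i := csInf_le (hbJ Q) ⟨H.mid_mem i hi, h⟩
        rw [min_eq_right h, max_eq_right (sub_nonneg.2 hti.1.le)]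
        have e : t - a i - (d i - a i) / (b i - a i) * (t - a i) =
            (b i - d i) * ((t - a i) / (b i - a i)) := by field_simp; ring
        have h3 : (t - a i) / (b i - a i) ≤ 1 := (div_le_one hba).2 (by linarith [hti.2])
        have h4 : 0 ≤ (t - a i) / (b i - a i) := div_nonneg (by linarith [hti.1]) hba.le
        rw [e, Real.norm_eq_abs, abs_of_nonneg (mul_nonneg (by linarith) h4)]
        calc _ ≤ b i - d i := mul_le_of_le_one_right (by linarith) h3
          _ ≤ _ := by rw [eb]; linarith
      · have h2 : d i ≤ sSup (Q ∩ Iic t) := le_csSup (hbI Q) ⟨H.mid_mem i hi, h⟩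
        rw [min_eq_left h, max_eq_right (by linarith)]
        have e : d i - a i - (d i - a i) / (b i - a i) * (t - a i) =
            (d i - a i) * ((b i - t) / (b i - a i)) := by field_simp; ring
        have h3 : (b i - t) / (b i - a i) ≤ 1 := (div_le_one hba).2 (by linarith [hti.1])
        have h4 : 0 ≤ (b i - t) / (b i - a i) := div_nonneg (by linarith [hti.2]) hba.le
        rw [e, Real.norm_eq_abs, abs_of_nonneg (mul_nonneg (by linarith) h4)]
        calc _ ≤ d i - a i := mul_le_of_le_one_right (by linarith) h3
          _ ≤ _ := by rw [ea]; linarith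
    · intro j hj hji
      rw [hzero j hj, norm_zero]
      intro htj
      exact (H.disjoint hj hi hji).le_bot
        ⟨⟨htj.1, htj.2.le⟩, ⟨hti.1, hti.2.le⟩⟩
  · push Not at hex
    rw [Finset.sum_eq_zero fun i hi => by rw [hzero i hi (hex i hi), norm_zero]]
    exact mul_nonneg (by linarith) (norm_nonneg _)

end Splitting

/-! ### Vanishing of total defects along an increasing sequence of sets. -/

section SplittingSequence

open Set Filter Topology

variable {Y : Type*} [NormedAddCommGroup Y] [NormedSpace ℝ Y]
  {P : ℕ → Set ℝ} {ι : ℕ → Type*} {D : ∀ k, Finset (ι k)} {a d b : ∀ k, ι k → ℝ}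

/-- Approximation in `L¹` preserves the convergence of total defects to zero. -/
theorem tendsto_sum_splitDefect_of_approx {μ : Measure ℝ}
    (H : ∀ k, IsSplitting (P k) (P (k + 1)) (D k) (a k) (d k) (b k)) {g : ℝ → Y}
    (hg : Integrable g μ)
    (happrox : ∀ ε > 0, ∃ h : ℝ → Y, Integrable h μ ∧ ∫ x, ‖g x - h x‖ ∂μ ≤ ε ∧
      Tendsto (fun k => ∑ i ∈ D k, ‖splitDefect μ h (a k i) (d k i) (b k i)‖) atTop (𝓝 0)) :
    Tendsto (fun k => ∑ i ∈ D k, ‖splitDefect μ g (a k i) (d k i) (b k i)‖) atTop (𝓝 0) := by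
  refine (Metric.tendsto_atTop).2 fun ε hε => ?_
  obtain ⟨h, hh, hgh, ht⟩ := happrox (ε / 4) (by linarith)
  obtain ⟨N, hN⟩ := Metric.tendsto_atTop.1 ht (ε / 2) (by linarith)
  refine ⟨N, fun k hk => ?_⟩
  have h1 := hN k hk
  have hnn : ∀ f : ℝ → Y, 0 ≤ ∑ i ∈ D k, ‖splitDefect μ f (a k i) (d k i) (b k i)‖ := fun f =>
    Finset.sum_nonneg fun i _ => norm_nonneg _
  rw [Real.dist_eq, sub_zero, abs_of_nonneg (hnn _)] at h1 ⊢
  have h2 := (H k).sum_norm_splitDefect_le (hg.sub hh)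
  have h3 : ∑ i ∈ D k, ‖splitDefect μ g (a k i) (d k i) (b k i)‖ ≤
      ∑ i ∈ D k, ‖splitDefect μ (g - h) (a k i) (d k i) (b k i)‖ +
      ∑ i ∈ D k, ‖splitDefect μ h (a k i) (d k i) (b k i)‖ := by
    rw [← Finset.sum_add_distrib]
    refine Finset.sum_le_sum fun i _ => ?_
    have e : splitDefect μ g (a k i) (d k i) (b k i) =
        splitDefect μ (g - h) (a k i) (d k i) (b k i) +
          splitDefect μ h (a k i) (d k i) (b k i) := by
      rw [← splitDefect_add (hg.sub hh) hh, sub_add_cancel]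
    rw [e]
    exact norm_add_le _ _
  simp only [Pi.sub_apply] at h2
  linarith

theorem tendsto_sum_splitDefect_add {μ : Measure ℝ} {g h : ℝ → Y}
    (hg : Integrable g μ) (hh : Integrable h μ)
    (htg : Tendsto (fun k => ∑ i ∈ D k, ‖splitDefect μ g (a k i) (d k i) (b k i)‖) atTop (𝓝 0))
    (hth : Tendsto (fun k => ∑ i ∈ D k, ‖splitDefect μ h (a k i) (d k i) (b k i)‖) atTop (𝓝 0)) :
    Tendsto (fun k => ∑ i ∈ D k, ‖splitDefect μ (g + h) (a k i) (d k i) (b k i)‖) atTop (𝓝 0) := by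
  have := htg.add hth
  rw [add_zero] at this
  refine squeeze_zero (fun k => Finset.sum_nonneg fun i _ => norm_nonneg _) (fun k => ?_) this
  rw [← Finset.sum_add_distrib]
  refine Finset.sum_le_sum fun i _ => ?_
  rw [splitDefect_add hg hh]
  exact norm_add_le _ _

/-- The nearest points of `P k` on either side of `t` form bounded monotone sequences, so their
successive differences tend to zero, whether or not the gap around `t` closes up. For `t` outside
`[0,1]` the indicator agrees almost everywhere with that for `0` or `1`. -/
theorem tendsto_sum_splitDefect_Iic [CompleteSpace Y] (hmono : ∀ k, P k ⊆ P (k + 1)) (hP : ∀ k, P k ⊆ Icc 0 1)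
    (h0 : ∀ k, 0 ∈ P k) (h1 : ∀ k, 1 ∈ P k)
    (H : ∀ k, IsSplitting (P k) (P (k + 1)) (D k) (a k) (d k) (b k)) (c : Y) (t : ℝ) :
    Tendsto (fun k => ∑ i ∈ D k, ‖splitDefect (volume.restrict (Ioc 0 1))
      ((Iic t).indicator fun _ => c) (a k i) (d k i) (b k i)‖) atTop (𝓝 0) := by
  have main : ∀ t ∈ Icc (0 : ℝ) 1,
      Tendsto (fun k => ∑ i ∈ D k, ‖splitDefect (volume.restrict (Ioc 0 1))
      ((Iic t).indicator fun _ => c) (a k i) (d k i) (b k i)‖) atTop (𝓝 0) := by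
    intro t ht
    have hbI : ∀ R : Set ℝ, BddAbove (R ∩ Iic t) := fun R => ⟨t, fun x hx => hx.2⟩
    have hbJ : ∀ R : Set ℝ, BddBelow (R ∩ Ici t) := fun R => ⟨t, fun x hx => hx.2⟩
    have hS : Monotone fun k => sSup (P k ∩ Iic t) := monotone_nat_of_le_succ fun k =>
      csSup_le_csSup (hbI _) ⟨0, h0 k, ht.1⟩ (inter_subset_inter_left _ (hmono k))
    have hI : Antitone fun k => sInf (P k ∩ Ici t) := antitone_nat_of_succ_le fun k =>
      csInf_le_csInf (hbJ _) ⟨1, h1 k, ht.2⟩ (inter_subset_inter_left _ (hmono k))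
    have lS := tendsto_atTop_ciSup hS ⟨t, by
      rintro _ ⟨k, rfl⟩
      exact csSup_le ⟨0, h0 k, ht.1⟩ fun x hx => hx.2⟩
    have lI := tendsto_atTop_ciInf hI ⟨t, by
      rintro _ ⟨k, rfl⟩
      exact le_csInf ⟨1, h1 k, ht.2⟩ fun x hx => hx.2⟩
    have l := ((((tendsto_add_atTop_iff_nat 1).2 lS).sub lS).add
      (lI.sub ((tendsto_add_atTop_iff_nat 1).2 lI))).mul_const ‖c‖
    rw [sub_self, sub_self, add_zero, zero_mul] at l
    exact squeeze_zero (fun k => Finset.sum_nonneg fun i _ => norm_nonneg _)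
      (fun k => (H k).sum_norm_splitDefect_Iic_le (hP k) (hP (k + 1)) (hmono k) (h0 k) (h1 k) c ht)
      l
  rcases lt_or_ge t 0 with h | h
  · convert main 0 (by simp) using 4 with k i hi
    refine splitDefect_congr_ae ?_ _ _ _
    filter_upwards [ae_restrict_mem measurableSet_Ioc] with x hx
    rw [indicator_of_notMem (fun hx' => by linarith [hx.1, mem_Iic.1 hx']),
      indicator_of_notMem (fun hx' => by linarith [hx.1, mem_Iic.1 hx'])]
  rcases le_or_gt t 1 with h' | h'
  · exact main t ⟨h, h'⟩
  · convert main 1 (by simp) using 4 with k i hi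
    refine splitDefect_congr_ae ?_ _ _ _
    filter_upwards [ae_restrict_mem measurableSet_Ioc] with x hx
    rw [indicator_of_mem (mem_Iic.2 (hx.2.trans h'.le)), indicator_of_mem (mem_Iic.2 hx.2)]

/-- For an increasing sequence of subsets of `[0, 1]`, the total deviation from affinity of a fixed
indefinite Bochner integral on split gaps tends to zero. -/
theorem tendsto_sum_splitDefect [CompleteSpace Y] (hmono : ∀ k, P k ⊆ P (k + 1)) (hP : ∀ k, P k ⊆ Icc 0 1)
    (h0 : ∀ k, 0 ∈ P k) (h1 : ∀ k, 1 ∈ P k)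
    (H : ∀ k, IsSplitting (P k) (P (k + 1)) (D k) (a k) (d k) (b k)) {g : ℝ → Y}
    (hg : Integrable g (volume.restrict (Ioc 0 1))) :
    Tendsto (fun k => ∑ i ∈ D k, ‖splitDefect (volume.restrict (Ioc 0 1)) g
      (a k i) (d k i) (b k i)‖) atTop (𝓝 0) := by
  set μ : Measure ℝ := volume.restrict (Ioc 0 1) with hμ
  have hIic := fun (c : Y) t => tendsto_sum_splitDefect_Iic hmono hP h0 h1 H c t
  have hconst : ∀ c : Y, Tendsto (fun k => ∑ i ∈ D k, ‖splitDefect μ (fun _ => c)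
      (a k i) (d k i) (b k i)‖) atTop (𝓝 0) := by
    intro c
    convert hIic c 1 using 4 with k i hi
    refine splitDefect_congr_ae ?_ _ _ _
    filter_upwards [ae_restrict_mem measurableSet_Ioc] with x hx
    rw [indicator_of_mem (mem_Iic.2 hx.2)]
  have hneg : ∀ h : ℝ → Y,
      Tendsto (fun k => ∑ i ∈ D k, ‖splitDefect μ h (a k i) (d k i) (b k i)‖) atTop (𝓝 0) →
      Tendsto (fun k => ∑ i ∈ D k, ‖splitDefect μ (-h) (a k i) (d k i) (b k i)‖)
        atTop (𝓝 0) := by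
    intro h hh
    refine hh.congr fun k => Finset.sum_congr rfl fun i _ => ?_
    rw [← norm_neg]
    simp only [splitDefect, Pi.neg_apply, integral_neg, smul_neg]
    congr 1
    abel
  have hzero : Tendsto (fun k => ∑ i ∈ D k, ‖splitDefect μ (0 : ℝ → Y)
      (a k i) (d k i) (b k i)‖) atTop (𝓝 0) := hconst 0
  have hind : ∀ (c : Y) (s : Set ℝ), MeasurableSet s →
      Tendsto (fun k => ∑ i ∈ D k, ‖splitDefect μ (s.indicator fun _ => c)
        (a k i) (d k i) (b k i)‖) atTop (𝓝 0) := by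
    intro c s hs
    have hint : ∀ s : Set ℝ, MeasurableSet s → Integrable (s.indicator fun _ => c) μ :=
      fun s hs => (integrable_const c).indicator hs
    -- Half-lines form a π-system generating the Borel sets. A countable disjoint union is
    -- approximated in `L¹` by its finite subunions.
    induction s, hs using MeasurableSpace.induction_on_inter
      (BorelSpace.measurable_eq.trans (borel_eq_generateFrom_Iic ℝ)) isPiSystem_Iic with
    | empty => rw [indicator_empty]; exact hzero
    | basic t ht =>
      obtain ⟨t, rfl⟩ := ht
      exact hIic c t
    | compl t htm ht =>
      rw [indicator_compl, sub_eq_add_neg]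
      exact tendsto_sum_splitDefect_add (integrable_const c) (hint t htm).neg (hconst c) (hneg _ ht)
    | iUnion f hf hfm ht =>
      have hfin : ∀ n : ℕ, Tendsto (fun k => ∑ i ∈ D k,
          ‖splitDefect μ ((⋃ j ∈ Finset.range n, f j).indicator fun _ => c)
            (a k i) (d k i) (b k i)‖) atTop (𝓝 0) := by
        intro n
        induction n with
        | zero =>
          simp only [Finset.range_zero, Finset.notMem_empty, iUnion_of_empty, iUnion_empty,
            indicator_empty]
          exact hzero
        | succ n ih =>
          rw [Finset.range_add_one, Finset.set_biUnion_insert, indicator_union_of_disjoint]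
          · exact tendsto_sum_splitDefect_add (hint _ (hfm n))
              (hint _ (Finset.measurableSet_biUnion _ fun i _ => hfm i)) (ht n) ih
          · simp only [disjoint_iUnion_right]
            intro j hj
            exact hf (Finset.mem_range.1 hj).ne'
      refine tendsto_sum_splitDefect_of_approx H (hint _ (MeasurableSet.iUnion hfm)) fun ε hε => ?_
      have hlim : Tendsto (fun n : ℕ => ∫ x, ‖(⋃ i, f i).indicator (fun _ => c) x -
          (⋃ j ∈ Finset.range n, f j).indicator (fun _ => c) x‖ ∂μ) atTop (𝓝 0) := by
        have hz : ∫ _ : ℝ, (0 : ℝ) ∂μ = 0 := integral_zero _ _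
        rw [← hz]
        refine tendsto_integral_of_dominated_convergence (fun _ => ‖c‖) (fun n =>
          ((hint _ (MeasurableSet.iUnion hfm)).sub
            (hint _ (Finset.measurableSet_biUnion _ fun i _ => hfm i))).norm.aestronglyMeasurable)
          (integrable_const _) (fun n => ae_of_all _ fun x => ?_) (ae_of_all _ fun x => ?_)
        · rw [norm_norm]
          by_cases hx : x ∈ ⋃ j ∈ Finset.range n, f j
          · rw [indicator_of_mem hx, indicator_of_mem (iUnion₂_subset_iUnion _ _ hx), sub_self,
              norm_zero]
            exact norm_nonneg _
          · rw [indicator_of_notMem hx, sub_zero]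
            exact norm_indicator_le_norm_self _ _
        · by_cases hx : x ∈ ⋃ i, f i
          · obtain ⟨j, hj⟩ := mem_iUnion.1 hx
            refine tendsto_const_nhds.congr' ?_
            filter_upwards [eventually_gt_atTop j] with n hn
            rw [indicator_of_mem hx, indicator_of_mem
              (mem_iUnion₂.2 ⟨j, Finset.mem_range.2 hn, hj⟩), sub_self, norm_zero]
          · refine tendsto_const_nhds.congr fun n => ?_
            rw [indicator_of_notMem hx, indicator_of_notMem
              (fun h => hx (iUnion₂_subset_iUnion _ _ h)), sub_self, norm_zero]
      obtain ⟨n, hn⟩ := (hlim.eventually (ge_mem_nhds hε)).exists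
      exact ⟨_, hint _ (Finset.measurableSet_biUnion _ fun i _ => hfm i), hn, hfin n⟩
  refine Integrable.induction (fun g => Integrable g μ → Tendsto (fun k => ∑ i ∈ D k,
    ‖splitDefect μ g (a k i) (d k i) (b k i)‖) atTop (𝓝 0)) (fun c s hs _ _ => hind c s hs)
    (fun f g _ hf hg h h' _ => tendsto_sum_splitDefect_add hf hg (h hf) (h' hg)) ?_
    (fun f g e hf h hg => ?_) hg hg
  · refine isClosed_of_closure_subset fun f hf _ => ?_
    refine tendsto_sum_splitDefect_of_approx H (L1.integrable_coeFn f) fun ε hε => ?_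
    obtain ⟨h, hh, hd⟩ := Metric.mem_closure_iff.1 hf ε hε
    refine ⟨h, L1.integrable_coeFn h, ?_, hh (L1.integrable_coeFn h)⟩
    rw [dist_eq_norm, L1.norm_eq_integral_norm] at hd
    refine le_trans (le_of_eq (integral_congr_ae ?_)) hd.le
    filter_upwards [Lp.coeFn_sub f h] with x hx
    rw [hx, Pi.sub_apply]
  · convert h hf using 4 with k i hi
    exact splitDefect_congr_ae e.symm _ _ _

/-- In a space with the Radon-Nikodym property, a Lipschitz function on the union of an increasing
sequence of subsets of `[0, 1]` cannot have total deviation from affinity bounded away from zero on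
split gaps of all the sets of the sequence. -/
theorem HasRNP.exists_sum_deviation_lt [CompleteSpace Y] (hY : HasRNP Y)
    (hmono : ∀ k, P k ⊆ P (k + 1)) (hP : ∀ k, P k ⊆ Icc 0 1)
    (h0 : ∀ k, 0 ∈ P k) (h1 : ∀ k, 1 ∈ P k)
    (H : ∀ k, IsSplitting (P k) (P (k + 1)) (D k) (a k) (d k) (b k)) {L : ℝ} (hL : 0 ≤ L)
    {V : ℝ → Y} (hV : ∀ k, ∀ x ∈ P k, ∀ y ∈ P k, x ≤ y → ‖V y - V x‖ ≤ L * (y - x))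
    {ε : ℝ} (hε : 0 < ε) :
    ∃ k, ∑ i ∈ D k, ‖(V (d k i) - V (a k i)) -
      ((d k i - a k i) / (b k i - a k i)) • (V (b k i) - V (a k i))‖ < ε := by
  have hPm : Monotone P := monotone_nat_of_le_succ hmono
  obtain ⟨F, hF, e⟩ := exists_lipschitz_extension (P := ⋃ k, P k) hL (mem_iUnion.2 ⟨0, h0 0⟩)
    (mem_iUnion.2 ⟨0, h1 0⟩) (iUnion_subset hP) (f := V) (by
      intro x hx y hy hxy
      obtain ⟨k, hk⟩ := mem_iUnion.1 hx
      obtain ⟨l, hl⟩ := mem_iUnion.1 hy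
      exact hV (max k l) x (hPm (le_max_left _ _) hk) y (hPm (le_max_right _ _) hl) hxy)
  obtain ⟨g, hg, hgF⟩ := hY.exists_density hL hF
  obtain ⟨k, hk⟩ :=
    ((tendsto_sum_splitDefect hmono hP h0 h1 H hg).eventually (gt_mem_nhds hε)).exists
  refine ⟨k, lt_of_eq_of_lt (Finset.sum_congr rfl fun i hi => ?_) hk⟩
  have ha := (H k).left_mem i hi
  have hb := (H k).right_mem i hi
  have hd := (H k).mid_mem i hi
  have hl := (H k).left_lt i hi
  have hr := (H k).lt_right i hi
  rw [splitDefect, ← hgF _ _ (hP k ha).1 hl.le (hP _ hd).2,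
    ← hgF _ _ (hP k ha).1 (hl.trans hr).le (hP k hb).2, e (mem_iUnion.2 ⟨k, ha⟩),
    e (mem_iUnion.2 ⟨k, hb⟩), e (mem_iUnion.2 ⟨_, hd⟩)]

end SplittingSequence

/-! ### Nested partitions and the positions of points of marked geodesics. -/

section Partitions

variable {X : Type*} [MetricSpace X]

theorem cumLength_zero {n : ℕ} (w : Fin (n + 1) → X) : cumLength w 0 = 0 := by
  simp [cumLength]

theorem cumLength_succ {n : ℕ} (w : Fin (n + 1) → X) (i : Fin n) :
    cumLength w i.succ = cumLength w i.castSucc + dist (w i.castSucc) (w i.succ) := by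
  have e : (Finset.univ.filter fun j : Fin n => j.castSucc < i.succ) =
      insert i (Finset.univ.filter fun j : Fin n => j.castSucc < i.castSucc) := by
    ext j
    simp only [Finset.mem_filter, Finset.mem_univ, true_and, Finset.mem_insert, Fin.lt_def,
      Fin.val_castSucc, Fin.val_succ, Fin.ext_iff]
    omega
  rw [cumLength, e, Finset.sum_insert (by simp), add_comm]
  rfl

theorem cumLength_of_val_succ {n : ℕ} (w : Fin (n + 1) → X) {a b : Fin (n + 1)}
    (h : a.val + 1 = b.val) : cumLength w b = cumLength w a + dist (w a) (w b) := by
  have hb := b.isLt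
  have eb : b = (⟨a.val, by omega⟩ : Fin n).succ := Fin.ext h.symm
  rw [eb]
  exact cumLength_succ w ⟨a.val, by omega⟩

theorem divisionPoints_sub {n : ℕ} (w : Fin (n + 1) → X) (i : Fin n) :
    divisionPoints w i.succ - divisionPoints w i.castSucc =
      dist (w i.castSucc) (w i.succ) / cumLength w (Fin.last n) := by
  rw [divisionPoints, divisionPoints, ← sub_div, cumLength_succ, add_sub_cancel_left]

theorem cumLength_last_nonneg {n : ℕ} (w : Fin (n + 1) → X) : 0 ≤ cumLength w (Fin.last n) :=
  Finset.sum_nonneg fun _ _ => dist_nonneg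

variable {𝓜 : ∀ n : ℕ, Set (Fin (n + 1) → X)} {B : ℝ}

theorem IsFinalPartition.mem {n : ℕ} {w : Fin (n + 1) → X} {α : Fin (n + 1) → ℝ}
    (h : IsFinalPartition 𝓜 w α) : w ∈ 𝓜 n := by
  cases h <;> assumption

namespace NonAccumulation

theorem divisionPoints_pos (hacc : NonAccumulation 𝓜 B) (hB : 1 ≤ B) {n : ℕ}
    {w : Fin (n + 1) → X} (hw : w ∈ 𝓜 n) (i : Fin n) :
    0 < dist (w i.castSucc) (w i.succ) / cumLength w (Fin.last n) := by
  have h := (hacc w _ (.single hw) i).1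
  rw [divisionPoints_sub] at h
  refine lt_of_le_of_ne (div_nonneg dist_nonneg (cumLength_last_nonneg w)) fun h0 => ?_
  rw [← h0, div_zero] at h
  have : 0 < 1 / B := by positivity
  linarith

theorem dist_pos (hacc : NonAccumulation 𝓜 B) (hB : 1 ≤ B) {n : ℕ}
    {w : Fin (n + 1) → X} (hw : w ∈ 𝓜 n) (i : Fin n) : 0 < dist (w i.castSucc) (w i.succ) :=
  lt_of_le_of_ne dist_nonneg fun h => by
    have := hacc.divisionPoints_pos hB hw i
    rw [← h, zero_div] at this
    exact this.false

theorem cumLength_strictMono (hacc : NonAccumulation 𝓜 B) (hB : 1 ≤ B) {n : ℕ}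
    {w : Fin (n + 1) → X} (hw : w ∈ 𝓜 n) : StrictMono (cumLength w) :=
  Fin.strictMono_iff_lt_succ.2 fun i => by
    rw [cumLength_succ]
    linarith [hacc.dist_pos hB hw i]

/-- The interval of the partition corresponding to `w` has length distance over total length, and
the one of `α` is at least `1 / B` of it. This is the source of the Lipschitz bound in terms of
position. -/
theorem dist_le (hacc : NonAccumulation 𝓜 B) (hB : 1 ≤ B) {n : ℕ}
    {w : Fin (n + 1) → X} {α : Fin (n + 1) → ℝ} (h : IsFinalPartition 𝓜 w α) (i : Fin n) :
    dist (w i.castSucc) (w i.succ) ≤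
      cumLength w (Fin.last n) * B * (α i.succ - α i.castSucc) := by
  have h1 := (hacc w α h i).1
  have h2 := hacc.divisionPoints_pos hB h.mem i
  have hl : 0 < cumLength w (Fin.last n) := lt_of_le_of_ne (cumLength_last_nonneg w) fun h0 => by
    rw [← h0, div_zero] at h2
    exact h2.false
  rw [divisionPoints_sub, div_le_div_iff₀ (by linarith) h2, one_mul, div_le_iff₀ hl] at h1
  linarith

theorem strictMono (hacc : NonAccumulation 𝓜 B) (hB : 1 ≤ B) {n : ℕ}
    {w : Fin (n + 1) → X} {α : Fin (n + 1) → ℝ} (h : IsFinalPartition 𝓜 w α) :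
    StrictMono α :=
  Fin.strictMono_iff_lt_succ.2 fun i => by
    have h1 := (hacc.dist_pos hB h.mem i).trans_le (hacc.dist_le hB h i)
    have h2 : 0 ≤ cumLength w (Fin.last n) * B :=
      mul_nonneg (cumLength_last_nonneg w) (by linarith)
    linarith [pos_of_mul_pos_right h1 h2]

end NonAccumulation

variable {n m : ℕ} {φ : Fin (n + 1) → Fin (m + 1)} {z : Fin (m + 1) → X}

/-- Old points keep their positions because the fraction in the refinement is `0` or `1` at the ends
of an interval. For `n = 0` there are no intervals and `β` would be unconstrained. -/
theorem IsRefinementAlong.apply_eq {α : Fin (n + 1) → ℝ} {β : Fin (m + 1) → ℝ}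
    (hβ : IsRefinementAlong φ z α β) (hφ : StrictMono φ) (hz : StrictMono (cumLength z))
    (hn : 0 < n) (k : Fin (n + 1)) : β (φ k) = α k := by
  obtain ⟨n, rfl⟩ := Nat.exists_eq_succ_of_ne_zero hn.ne'
  induction k using Fin.cases with
  | zero =>
    have := hβ 0 (φ 0) le_rfl (hφ (Fin.castSucc_lt_succ (i := 0))).le
    simpa using this
  | succ i =>
    have hlt := hφ (Fin.castSucc_lt_succ (i := i))
    rw [hβ i (φ i.succ) hlt.le le_rfl, mul_div_assoc, div_self (sub_pos.2 (hz hlt)).ne']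
    ring

theorem exists_isRefinementAlong (α : Fin (n + 1) → ℝ) (hφ : StrictMono φ) (hφ0 : φ 0 = 0)
    (hφn : φ (Fin.last n) = Fin.last m) (hz : StrictMono (cumLength z)) (hn : 0 < n) :
    ∃ β, IsRefinementAlong φ z α β := by
  have hex : ∀ j : Fin (m + 1), ∃ i : Fin n, φ i.castSucc ≤ j ∧ j ≤ φ i.succ := by
    intro j
    have h : ∀ k : Fin (n + 1), j ≤ φ k → j = 0 ∨ ∃ i : Fin n, φ i.castSucc ≤ j ∧ j ≤ φ i.succ := by
      intro k
      induction k using Fin.induction with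
      | zero => exact fun h => Or.inl (by rw [hφ0] at h; exact Fin.le_zero_iff.1 h)
      | succ i ih =>
        intro h
        rcases le_total (φ i.castSucc) j with h' | h'
        · exact Or.inr ⟨i, h', h⟩
        · exact ih h'
    rcases h (Fin.last n) (hφn ▸ Fin.le_last j) with rfl | h
    · exact ⟨⟨0, hn⟩, hφ0.le, Fin.zero_le _⟩
    · exact h
  choose I hI1 hI2 using hex
  let G : Fin n → Fin (m + 1) → ℝ := fun i j =>
    α i.castSucc + (α i.succ - α i.castSucc) * (cumLength z j - cumLength z (φ i.castSucc)) /
      (cumLength z (φ i.succ) - cumLength z (φ i.castSucc))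
  -- An index belonging to two intervals is the common end of adjacent ones, where both formulas
  -- give the same division point.
  have hG : ∀ i i' : Fin n, i < i' → ∀ j, j ≤ φ i.succ → φ i'.castSucc ≤ j → G i j = G i' j := by
    intro i i' hii j h1 h2
    have hle : i.succ ≤ i'.castSucc := Fin.succ_le_castSucc_iff.2 hii
    have e : i.succ = i'.castSucc :=
      le_antisymm hle (hφ.le_iff_le.1 (h2.trans h1))
    have ej : j = φ i.succ := le_antisymm h1 (e ▸ h2)
    have hlt := hφ (Fin.castSucc_lt_succ (i := i))
    simp only [G, ← e, ej]
    rw [mul_div_assoc, div_self (sub_pos.2 (hz hlt)).ne']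
    simp
  refine ⟨fun j => G (I j) j, fun i j h1 h2 => ?_⟩
  change G (I j) j = G i j
  rcases lt_trichotomy i (I j) with h | h | h
  · exact (hG i (I j) h j h2 (hI1 j)).symm
  · rw [h]
  · exact hG (I j) i h j (hI2 j) h1

theorem IsFinalPartition.end_points (hpos : ∀ n, ∀ w ∈ 𝓜 n, StrictMono (cumLength w))
    (hlen : ∀ n, (𝓜 n).Nonempty → 0 < n) {w : Fin (n + 1) → X} {α : Fin (n + 1) → ℝ}
    (h : IsFinalPartition 𝓜 w α) : α 0 = 0 ∧ α (Fin.last n) = 1 := by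
  induction h with
  | @single n w hw =>
    refine ⟨by rw [divisionPoints, cumLength_zero, zero_div], div_self ?_⟩
    rw [← cumLength_zero w]
    exact (hpos n w hw).injective.ne (Fin.ne_of_gt (hlen n ⟨w, hw⟩))
  | @extend n m w α φ z β hw hz hφ hβ ih =>
    have key := hβ.apply_eq hφ.1 (hpos m z hz) (hlen n ⟨w, hw.mem⟩)
    rw [← ih.1, ← ih.2, ← key, ← key, hφ.2.1, hφ.2.2.1]
    exact ⟨rfl, rfl⟩

/-- A marked sequence together with the final partition of a chain of extensions ending in it. -/
structure MarkedStage (𝓜 : ∀ n : ℕ, Set (Fin (n + 1) → X)) where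
  length : ℕ
  seq : Fin (length + 1) → X
  pos : Fin (length + 1) → ℝ
  isFinal : IsFinalPartition 𝓜 seq pos

namespace MarkedStage

/-- The stage `T` contains all the points of the stage `S`, at the same positions. -/
def Refines (S T : MarkedStage 𝓜) : Prop :=
  ∀ i, ∃ j, T.pos j = S.pos i ∧ T.seq j = S.seq i

theorem Refines.refl (S : MarkedStage 𝓜) : S.Refines S := fun i => ⟨i, rfl, rfl⟩

theorem Refines.trans {S T R : MarkedStage 𝓜} (h : S.Refines T) (h' : T.Refines R) :
    S.Refines R := by
  intro i
  obtain ⟨j, hj, hj'⟩ := h i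
  obtain ⟨k, hk, hk'⟩ := h' j
  exact ⟨k, hk.trans hj, hk'.trans hj'⟩

theorem Refines.range_subset {S T : MarkedStage 𝓜} (h : S.Refines T) :
    Set.range S.pos ⊆ Set.range T.pos := by
  rintro _ ⟨i, rfl⟩
  obtain ⟨j, hj, -⟩ := h i
  exact ⟨j, hj⟩

/-- Telescoping over consecutive points reduces this to `NonAccumulation.dist_le`; the bound is
uniform over stages, since `l` can be `C * dist u v`. -/
theorem norm_apply_sub_le {Y : Type*} [NormedAddCommGroup Y] (hacc : NonAccumulation 𝓜 B) (hB : 1 ≤ B)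
    {l K : ℝ} (hK : 0 ≤ K) {f : X → Y} (hf : ∀ x y, ‖f x - f y‖ ≤ K * dist x y)
    (S : MarkedStage 𝓜) (hl : cumLength S.seq (Fin.last _) ≤ l) {i j : Fin (S.length + 1)}
    (hij : i ≤ j) : ‖f (S.seq j) - f (S.seq i)‖ ≤ K * l * B * (S.pos j - S.pos i) := by
  have hmono := hacc.strictMono hB S.isFinal
  induction j using Fin.induction with
  | zero =>
    obtain rfl : i = 0 := Fin.le_zero_iff.1 hij
    simp
  | succ j ih =>
    rcases hij.eq_or_lt with rfl | h
    · simp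
    · have h1 := ih (Fin.le_castSucc_iff.2 h)
      have h2 := hf (S.seq j.succ) (S.seq j.castSucc)
      rw [dist_comm] at h2
      have h3 := hacc.dist_le hB S.isFinal j
      have h4 : 0 < S.pos j.succ - S.pos j.castSucc :=
        sub_pos.2 (hmono (Fin.castSucc_lt_succ (i := j)))
      have h5 : K * dist (S.seq j.castSucc) (S.seq j.succ) ≤
          K * (l * B * (S.pos j.succ - S.pos j.castSucc)) :=
        mul_le_mul_of_nonneg_left (h3.trans (by gcongr)) hK
      calc _ ≤ ‖f (S.seq j.succ) - f (S.seq j.castSucc)‖ + ‖f (S.seq j.castSucc) - f (S.seq i)‖ :=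
            norm_sub_le_norm_sub_add_norm_sub _ _ _
        _ ≤ K * (l * B * (S.pos j.succ - S.pos j.castSucc)) +
            K * l * B * (S.pos j.castSucc - S.pos i) := add_le_add (h2.trans h5) h1
        _ = _ := by ring

end MarkedStage

end Partitions

/-! ### Forks with large deviation, and gluing of stages. -/

section Fork

/-- This inserts the common points of a fork as an intermediate term of the chain, between `w` and a
mixture. -/
theorem IsExtensionAlong.factor {X : Type*} {n m k : ℕ} {φ : Fin (n + 1) → Fin (m + 1)}
    {ψ : Fin (k + 1) → Fin (m + 1)} {w : Fin (n + 1) → X} {z : Fin (m + 1) → X}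
    (hφ : IsExtensionAlong φ w z) (hψ : StrictMono ψ) (h : ∀ i, φ i ∈ Set.range ψ) :
    (∃ χ, IsExtensionAlong χ w (z ∘ ψ)) ∧ ψ 0 = 0 ∧ ψ (Fin.last k) = Fin.last m := by
  choose χ hχ using h
  obtain ⟨hmono, h0, hn, hw⟩ := hφ
  have e0 : χ 0 = 0 := Fin.le_zero_iff.1 (hψ.le_iff_le.1 (by rw [hχ, h0]; exact Fin.zero_le _))
  have en : χ (Fin.last n) = Fin.last k :=
    Fin.last_le_iff.1 (hψ.le_iff_le.1 (by rw [hχ, hn]; exact Fin.le_last _))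
  refine ⟨⟨χ, fun i j hij => hψ.lt_iff_lt.1 (by rw [hχ, hχ]; exact hmono hij), e0, en,
    fun i => ?_⟩, ?_, ?_⟩
  · rw [Function.comp_apply, hχ, hw]
  · rw [← e0, hχ, h0]
  · rw [← en, hχ, hn]

theorem div_add_eq_of_div_eq {p q p' q' : ℝ} (hp : 0 < p) (hq : 0 < q) (hp' : 0 < p')
    (hq' : 0 < q') (h : p / q = p' / q') : p / (p + q) = p' / (p' + q') := by
  rw [div_eq_div_iff hq.ne' hq'.ne'] at h
  rw [div_eq_div_iff (by positivity) (by positivity)]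
  linarith

variable {X : Type*} [MetricSpace X] {𝓜 : ∀ n : ℕ, Set (Fin (n + 1) → X)} {B : ℝ}

theorem NonAccumulation.dist_pos_of_val_succ (hacc : NonAccumulation 𝓜 B) (hB : 1 ≤ B) {n : ℕ}
    {w : Fin (n + 1) → X} (hw : w ∈ 𝓜 n) {a b : Fin (n + 1)} (h : a.val + 1 = b.val) :
    0 < dist (w a) (w b) := by
  have := hacc.cumLength_strictMono hB hw (Fin.lt_def.2 (by omega) : a < b)
  rw [cumLength_of_val_succ w h] at this
  linarith

namespace MarkedStage

theorem exists_extension (hpos : ∀ n, ∀ w ∈ 𝓜 n, StrictMono (cumLength w))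
    (hlen : ∀ n, (𝓜 n).Nonempty → 0 < n) (S : MarkedStage 𝓜) {m : ℕ} {z : Fin (m + 1) → X}
    (hz : z ∈ 𝓜 m) {φ : Fin (S.length + 1) → Fin (m + 1)} (hφ : IsExtensionAlong φ S.seq z) :
    ∃ β, ∃ h : IsFinalPartition 𝓜 z β, IsRefinementAlong φ z S.pos β ∧
      (∀ i, β (φ i) = S.pos i) ∧ S.Refines ⟨m, z, β, h⟩ := by
  have hn := hlen _ ⟨_, S.isFinal.mem⟩
  obtain ⟨β, hβ⟩ := exists_isRefinementAlong S.pos hφ.1 hφ.2.1 hφ.2.2.1 (hpos m z hz) hn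
  have h := hβ.apply_eq hφ.1 (hpos m z hz) hn
  exact ⟨β, .extend S.isFinal hz hφ hβ, hβ, h, fun i => ⟨φ i, h i, hφ.2.2.2 i⟩⟩

/-- `T` consists of the common points and `R` is a mixture. Passing through `T` makes the neighbours
of each `i ∈ D` the ends of a gap of placed points, and the equal distance ratios put both
candidates at the same proportion of that gap. Both are thus compared with the same affine
interpolation. -/
theorem exists_fork {Y : Type*} [NormedAddCommGroup Y] [NormedSpace ℝ Y]
    (hacc : NonAccumulation 𝓜 B) (hB : 1 ≤ B)
    (hlen : ∀ n, (𝓜 n).Nonempty → 0 < n) (f : X → Y) {K s : ℝ} (hK : 0 ≤ K)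
    (hf : ∀ x y, dist x y ≤ K * ‖f x - f y‖)
    (hext : ∀ n, ∀ w ∈ 𝓜 n, ∃ (m : ℕ) (z z' : Fin (m + 1) → X), IsForkedExtension 𝓜 s w z z')
    (S : MarkedStage 𝓜) :
    ∃ T R : MarkedStage 𝓜, S.Refines T ∧ T.Refines R ∧
      ∃ (D : Finset (Fin (R.length + 1))) (a b : Fin (R.length + 1) → Fin (R.length + 1)),
        IsSplitting (Set.range T.pos) (Set.range R.pos) D (R.pos ∘ a) R.pos (R.pos ∘ b) ∧
        s ≤ 2 * K * ∑ i ∈ D, ‖(f (R.seq i) - f (R.seq (a i))) -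
          ((R.pos i - R.pos (a i)) / (R.pos (b i) - R.pos (a i))) •
            (f (R.seq (b i)) - f (R.seq (a i)))‖ := by
  have hpos : ∀ n, ∀ w ∈ 𝓜 n, StrictMono (cumLength w) := fun n w hw =>
    hacc.cumLength_strictMono hB hw
  obtain ⟨m, z, z', H⟩ := hext _ _ S.isFinal.mem
  obtain ⟨φ, hφz, hφz', -⟩ := H.extends_both
  obtain ⟨k, ψ, hψ, hrange, hcommon⟩ := H.common_mem
  have hmem : ∀ i, i ∈ Set.range ψ ↔ z i = z' i := fun i => by rw [hrange]; rfl
  obtain ⟨⟨χ, hχ⟩, hψ0, hψk⟩ := hφz.factor hψ fun i =>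
    (hmem _).2 ((hφz.2.2.2 i).trans (hφz'.2.2.2 i).symm)
  obtain ⟨γ, hγ, -, -, hST⟩ := S.exists_extension hpos hlen hcommon hχ
  obtain ⟨D, -, hD, hsum⟩ := H.separated
  choose! hne a b ha hb hca hcb hratio using hD
  let ratio : Fin (m + 1) → ℝ := fun i =>
    dist (z i) (z (a i)) / (dist (z i) (z (a i)) + dist (z i) (z (b i)))
  let dev : Fin (m + 1) → X → Y := fun i p =>
    (f p - f (z (a i))) - ratio i • (f (z (b i)) - f (z (a i)))
  classical
  -- At each index the candidate with the larger deviation is taken; mixtures are marked, so the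
  -- choices are independent.
  let y : Fin (m + 1) → X := fun i => if ‖dev i (z' i)‖ ≤ ‖dev i (z i)‖ then z i else z' i
  have hy : ∀ i, y i = z i ∨ y i = z' i := fun i => by
    by_cases h : ‖dev i (z' i)‖ ≤ ‖dev i (z i)‖
    · exact Or.inl (if_pos h)
    · exact Or.inr (if_neg h)
  have hyc : ∀ i, z i = z' i → y i = z i := fun i h =>
    (hy i).elim id fun h' => h'.trans h.symm
  have hymem := H.mixture_mem y hy
  obtain ⟨β, hβ, href, hβγ, hTR⟩ := MarkedStage.exists_extension hpos hlen ⟨k, z ∘ ψ, γ, hγ⟩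
    hymem (φ := ψ) ⟨hψ, hψ0, hψk, fun i => hyc _ ((hmem _).1 ⟨i, rfl⟩)⟩
  have hβmono := hacc.strictMono hB hβ
  have hai : ∀ i ∈ D, a i < i := fun i hi => Fin.lt_def.2 (by have := ha i hi; omega)
  have hib : ∀ i ∈ D, i < b i := fun i hi => Fin.lt_def.2 (by have := hb i hi; omega)
  have hgap : ∀ i ∈ D, ∀ j, ψ j ≤ a i ∨ b i ≤ ψ j := by
    intro i hi j
    have hji : ψ j ≠ i := fun h => hne i hi ((hmem i).1 ⟨j, h⟩)
    have h1 := ha i hi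
    have h2 := hb i hi
    have h3 : (ψ j).val ≠ i.val := fun h => hji (Fin.ext h)
    simp only [Fin.le_def]
    omega
  -- No common index lies strictly between `a i` and `b i`, so these bound one interval of `γ`,
  -- which the refinement divides in proportion to the distances.
  have hposratio : ∀ i ∈ D, (β i - β (a i)) / (β (b i) - β (a i)) = ratio i := by
    intro i hi
    obtain ⟨p, hp⟩ := (hmem _).2 (hca i hi)
    obtain ⟨q, hq⟩ := (hmem _).2 (hcb i hi)
    have hpq : p < q := hψ.lt_iff_lt.1 (by rw [hp, hq]; exact (hai i hi).trans (hib i hi))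
    obtain ⟨r, rfl⟩ := Fin.eq_castSucc_of_ne_last (Fin.ne_last_of_lt hpq)
    have hr : ψ r.succ = b i := by
      refine le_antisymm ?_ ((hgap i hi r.succ).resolve_left
        (not_le.2 (hp ▸ hψ (Fin.castSucc_lt_succ (i := r)))))
      rw [← hq]
      exact hψ.monotone (Fin.castSucc_lt_iff_succ_le.1 hpq)
    have e := href r i (by rw [hp]; exact (hai i hi).le) (by rw [hr]; exact (hib i hi).le)
    have e1 := hβγ r.castSucc
    have e2 := hβγ r.succ
    simp only at e e1 e2
    rw [← e1, ← e2, hp, hr] at e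
    have hβab := hβmono ((hai i hi).trans (hib i hi))
    rw [e, add_sub_cancel_left, mul_div_assoc, mul_div_cancel_left₀ _ (sub_pos.2 hβab).ne',
      cumLength_of_val_succ y (hb i hi), cumLength_of_val_succ y (ha i hi), add_sub_cancel_left,
      add_assoc, add_sub_cancel_left, hyc _ (hca i hi), hyc _ (hcb i hi), dist_comm (z (a i))]
    rcases hy i with h | h
    · rw [h]
    · rw [h]
      have d1 := hacc.dist_pos_of_val_succ hB H.mem_left (ha i hi)
      have d2 := hacc.dist_pos_of_val_succ hB H.mem_left (hb i hi)
      have d3 := hacc.dist_pos_of_val_succ hB H.mem_right (ha i hi)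
      have d4 := hacc.dist_pos_of_val_succ hB H.mem_right (hb i hi)
      rw [← hca i hi] at d3
      rw [← hcb i hi] at d4
      rw [dist_comm] at d1 d3
      exact (div_add_eq_of_div_eq d1 d2 d3 d4 (hratio i hi)).symm
  refine ⟨⟨k, z ∘ ψ, γ, hγ⟩, ⟨m, y, β, hβ⟩, hST, hTR, D, a, b, ?_, ?_⟩
  · have hT : ∀ i, z i = z' i → β i ∈ Set.range γ := fun i hi => by
      obtain ⟨p, rfl⟩ := (hmem i).2 hi
      exact ⟨p, (hβγ p).symm⟩
    refine ⟨fun i hi => hT _ (hca i hi), fun i hi => hT _ (hcb i hi), fun i _ => ⟨i, rfl⟩,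
      fun i hi => hβmono (hai i hi), fun i hi => hβmono (hib i hi), ?_, ?_⟩
    · rintro i hi _ ⟨p, rfl⟩
      have e := hβγ p
      simp only at e
      simp only [← e, Function.comp_apply, hβmono.le_iff_le]
      exact hgap i hi p
    -- The index `b i = i + 1` is common while `j ∈ D` is not, so `j ≥ i + 2`.
    · have hlt : ∀ i ∈ D, ∀ j ∈ D, i < j → b i ≤ a j := by
        intro i hi j hj hij
        have h1 := hb i hi
        have h2 := ha j hj
        have h3 : j ≠ b i := fun h => hne j hj (h ▸ hcb i hi)
        have h4 : j.val ≠ (b i).val := fun h => h3 (Fin.ext h)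
        rw [Fin.lt_def] at hij
        rw [Fin.le_def]
        omega
      intro i hi j hj hij
      rcases lt_or_gt_of_ne hij with h | h
      · exact Set.Ioc_disjoint_Ioc_of_le (hβmono.monotone (hlt i hi j hj h))
      · exact (Set.Ioc_disjoint_Ioc_of_le (hβmono.monotone (hlt j hj i hi h))).symm
  · refine hsum.trans ?_
    rw [Finset.mul_sum]
    refine Finset.sum_le_sum fun i hi => ?_
    simp only
    rw [hposratio i hi, hyc _ (hca i hi), hyc _ (hcb i hi)]
    change _ ≤ 2 * K * ‖dev i (y i)‖
    have h1 : f (z i) - f (z' i) = dev i (z i) - dev i (z' i) := by simp only [dev]; abel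
    have h2 := hf (z i) (z' i)
    rw [h1] at h2
    have h3 : ‖dev i (z i) - dev i (z' i)‖ ≤ 2 * ‖dev i (y i)‖ := by
      have h4 := norm_sub_le (dev i (z i)) (dev i (z' i))
      by_cases h : ‖dev i (z' i)‖ ≤ ‖dev i (z i)‖
      · have : y i = z i := if_pos h
        rw [this]; linarith
      · have : y i = z' i := if_neg h
        rw [this]; linarith
    calc _ ≤ _ := h2
      _ ≤ K * (2 * ‖dev i (y i)‖) := by gcongr
      _ = _ := by ring

end MarkedStage

/-- Partial functions on an increasing sequence of stages glue to a function on the line. -/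
theorem exists_glued_function {Y : Type*} [Zero Y] (hmono : ∀ S : MarkedStage 𝓜, StrictMono S.pos)
    (T : ℕ → MarkedStage 𝓜) (hT : ∀ k, (T k).Refines (T (k + 1))) (f : X → Y) :
    ∃ V : ℝ → Y, ∀ k i, V ((T k).pos i) = f ((T k).seq i) := by
  classical
  have hle : ∀ k l, k ≤ l → (T k).Refines (T l) := fun k l hkl => by
    induction l, hkl using Nat.le_induction with
    | base => exact .refl _
    | succ l _ ih => exact ih.trans (hT l)
  refine ⟨fun t => if h : ∃ x, ∃ k i, (T k).pos i = t ∧ (T k).seq i = x then f h.choose else 0,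
    fun k i => ?_⟩
  have h : ∃ x, ∃ l j, (T l).pos j = (T k).pos i ∧ (T l).seq j = x := ⟨_, k, i, rfl, rfl⟩
  simp only [h, dite_true]
  obtain ⟨l, j, h1, h2⟩ := h.choose_spec
  -- The chosen point may come from any stage. At a stage refining both, positions are injective, so
  -- the two points coincide.
  obtain ⟨i', hi1, hi2⟩ := hle k (max k l) (le_max_left _ _) i
  obtain ⟨j', hj1, hj2⟩ := hle l (max k l) (le_max_right _ _) j
  have e : i' = j' := (hmono _).injective (by rw [hi1, hj1, h1])
  rw [← h2, ← hj2, ← e, hi2]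

end Fork

/-! ### Iterating the fork and the contradiction. -/

theorem theorem4p6 {X : Type*} [MetricSpace X] (u v : X) (C : ℝ) (hC : 1 ≤ C)
    (𝓜 : ∀ n : ℕ, Set (Fin (n + 1) → X))
    (hne : ∃ n, (𝓜 n).Nonempty)
    (hgeo : ∀ n, ∀ w ∈ 𝓜 n, IsCGeodesic C u v w)
    (hext : ∃ c : ℝ, 0 < c ∧ ∀ n, ∀ w ∈ 𝓜 n,
      ∃ (m : ℕ) (z z' : Fin (m + 1) → X), IsForkedExtension 𝓜 (c * dist u v) w z z')
    (hacc : ∃ B : ℝ, 1 ≤ B ∧ NonAccumulation 𝓜 B)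
    {Y : Type*} [NormedAddCommGroup Y] [NormedSpace ℝ Y] [CompleteSpace Y] (hY : HasRNP Y) :
    ¬ BilipschitzEmbeds X Y := by
  rintro ⟨f, ⟨K, hfK⟩, ⟨K', hfK'⟩⟩
  obtain ⟨c, hc, hext⟩ := hext
  obtain ⟨B, hB, hacc⟩ := hacc
  obtain ⟨n₀, w₀, hw₀⟩ := hne
  have huv : 0 < dist u v := by
    obtain ⟨m, z, z', H⟩ := hext n₀ w₀ hw₀
    obtain ⟨D, ⟨i, hi⟩, hD, -⟩ := H.separated
    obtain ⟨-, a, b, ha, -⟩ := hD i hi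
    have h1 := hacc.cumLength_strictMono hB H.mem_left (Fin.lt_def.2 (by omega) : a < i)
    have h2 := (hacc.cumLength_strictMono hB H.mem_left).monotone (Fin.le_last i)
    have h3 := (hacc.cumLength_strictMono hB H.mem_left).monotone (Fin.zero_le a)
    rw [cumLength_zero] at h3
    have h4 := (hgeo m z H.mem_left).2.2
    by_contra h
    have h5 : dist u v = 0 := le_antisymm (not_lt.1 h) dist_nonneg
    rw [h5, mul_zero] at h4
    linarith
  have hlen : ∀ n, (𝓜 n).Nonempty → 0 < n := by
    rintro n ⟨w, hw⟩
    refine Nat.pos_of_ne_zero fun h => ?_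
    subst h
    obtain ⟨h1, h2, -⟩ := hgeo 0 w hw
    have : u = v := h1.symm.trans h2
    rw [this, dist_self] at huv
    exact huv.false
  have hstep := MarkedStage.exists_fork hacc hB hlen f K'.coe_nonneg
    (fun x y => by rw [← dist_eq_norm]; exact hfK'.le_mul_dist x y) hext
  choose T R hST hTR D a b hsplit hdev using hstep
  -- Each mixture is forked again. The sets of the splitting sequence are the positions of `T (S
  -- k)`, with `R (S k)` lying between `T (S k)` and `T (S (k + 1))`.
  let S : ℕ → MarkedStage 𝓜 := fun k => Nat.rec ⟨n₀, w₀, _, .single hw₀⟩ (fun _ S => R S) k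
  have hRT : ∀ k, (R (S k)).Refines (T (S (k + 1))) := fun k => hST (S (k + 1))
  have hTT : ∀ k, (T (S k)).Refines (T (S (k + 1))) := fun k => (hTR (S k)).trans (hRT k)
  obtain ⟨V, hV⟩ := exists_glued_function (fun S => hacc.strictMono hB S.isFinal)
    (fun k => T (S k)) hTT f
  have hVR : ∀ k i, V ((R (S k)).pos i) = f ((R (S k)).seq i) := by
    intro k i
    obtain ⟨j, h1, h2⟩ := hRT k i
    rw [← h1, ← h2]
    exact hV (k + 1) j
  have hends : ∀ S : MarkedStage 𝓜, S.pos 0 = 0 ∧ S.pos (Fin.last _) = 1 := fun S =>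
    S.isFinal.end_points (fun n w hw => hacc.cumLength_strictMono hB hw) hlen
  have hl : 0 ≤ C * dist u v := by positivity
  have hsplit' : ∀ k, IsSplitting (Set.range (T (S k)).pos) (Set.range (T (S (k + 1))).pos)
      (D (S k)) ((R (S k)).pos ∘ a (S k)) (R (S k)).pos ((R (S k)).pos ∘ b (S k)) := fun k =>
    { hsplit (S k) with mid_mem := fun i hi => (hRT k).range_subset ⟨i, rfl⟩ }
  -- The added `1` avoids having to show `K' ≠ 0`.
  have hK' : 0 < 2 * (K' : ℝ) + 1 := by positivity
  obtain ⟨k, hk⟩ := hY.exists_sum_deviation_lt (P := fun k => Set.range (T (S k)).pos)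
    (fun k => (hTT k).range_subset) (by
      rintro k _ ⟨i, rfl⟩
      have hm := (hacc.strictMono hB (T (S k)).isFinal).monotone
      exact ⟨(hends _).1.symm.trans_le (hm (Fin.zero_le i)),
        (hm (Fin.le_last i)).trans_eq (hends _).2⟩)
    (fun k => ⟨_, (hends _).1⟩) (fun k => ⟨_, (hends _).2⟩) hsplit'
    (L := K * (C * dist u v) * B) (by positivity) (V := V) (by
      rintro k _ ⟨i, rfl⟩ _ ⟨j, rfl⟩ hij
      have e := hV k
      rw [e, e]
      exact MarkedStage.norm_apply_sub_le hacc hB K.2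
        (fun x y => by rw [← dist_eq_norm]; exact hfK.dist_le_mul x y) _
        (hgeo _ _ (T (S k)).isFinal.mem).2.2
        ((hacc.strictMono hB (T (S k)).isFinal).le_iff_le.1 hij))
    (ε := c * dist u v / (2 * K' + 1)) (by positivity)
  have h1 := hdev (S k)
  simp only [Function.comp_apply, hVR] at hk
  rw [lt_div_iff₀ hK'] at hk
  refine absurd h1 (not_le.2 (lt_of_le_of_lt ?_ hk))
  refine (mul_comm _ _).trans_le ?_
  exact mul_le_mul_of_nonneg_left (by linarith)
    (Finset.sum_nonneg fun i _ => norm_nonneg _)
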